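/- Let $k$ be a field of characteristic zero. Let $T$ be the vector space spanned by the (isomorphism classes of) nonempty non-planar rooted trees, $T'$ the one spanned by those with at least one edge, and $\bullet$ the one-vertex tree. As algebras, $\widetilde{\mathcal H}=\mathcal H_{CK}=S(T)$ and $\mathcal H=S(T')$, the unit of $\mathcal H$ being identified with $\bullet$. The Connes--Kreimer coproduct on $\mathcal H_{CK}$ is the algebra morphism with $\Delta_{CK}(t)=t\otimes 1+\sum_c P^c(t)\otimes R^c(t)$, where $c$ runs over the admissible cuts of the tree $t$ (including the empty cut), $P^c(t)$ is the pruned forest and $R^c(t)$ the trunk; $*$ denotes the corresponding convolution of linear forms on $\mathcal H_{CK}$, and $\varepsilon$ the counit. Let $\Phi:\mathcal H_{CK}\to\mathcal H\otimes\mathcal H_{CK}$ (respectively $\widetilde\Phi:\mathcal H_{CK}\to\widetilde{\mathcal H}\otimes\mathcal H_{CK}$) be the algebra morphism with $t\mapsto\sum_{s} s\otimes t/s$ for every nonempty tree $t$, where $s$ runs over the subforests of $t$ whose components have at least one edge, including the trivial subforest (respectively over the spanning subforests of $t$), and $t/s$ is the tree obtained by contracting each component of $s$ to a vertex. For a linear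 form $\varphi$ on $\mathcal H$ (respectively $\widetilde{\mathcal H}$) and a linear form $b$ on $\mathcal H_{CK}$ put $\varphi\star b=(\varphi\otimes b)\circ\Phi$ (respectively $(\varphi\otimes b)\circ\widetilde\Phi$). Characters are unital algebra morphisms to $k$; an infinitesimal character of $\mathcal H_{CK}$ is a linear form $\xi$ with $\xi(xy)=\xi(x)\varepsilon(y)+\varepsilon(x)\xi(y)$. Let $\delta_\bullet$ be the element dual to $\bullet$ in the dual of the forest basis of $\mathcal H_{CK}$, and $\delta$ the character of $\mathcal H_{CK}$ with $\delta(\bullet)=1$ and $\delta(t)=0$ for every other nonempty tree $t$. 1. For every character $\varphi$ of $\mathcal H$, $\varphi\star\delta_\bullet$ is the unique infinitesimal character of $\mathcal H_{CK}$ that coincides with $\varphi$ on nonempty trees, and $\varphi\mapsto\varphi\star\delta_\bullet$ is a bijection from the characters of $\mathcal H$ onto the infinitesimal characters of $\mathcal H_{CK}$ taking the value $1$ on $\bullet$. 2. For every character $\varphi$ of $\mathcal H$, $\varphi\star\delta$ is the unique character of $\mathcal H_{CK}$ that coincides with $\varphi$ on nonempty trees, and $\varphi\mapsto\varphi\star\delta$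 is a bijection from the characters of $\mathcal H$ onto the characters of $\mathcal H_{CK}$ taking the value $1$ on $\bullet$. 3. For every character $\varphi$ of $\widetilde{\mathcal H}$, $\varphi\star\delta_\bullet$ is the unique infinitesimal character of $\mathcal H_{CK}$ that coincides with $\varphi$ on nonempty trees, and $\varphi\mapsto\varphi\star\delta_\bullet$ is a bijection from the characters of $\widetilde{\mathcal H}$ onto the infinitesimal characters of $\mathcal H_{CK}$. 4. For every character $\varphi$ of $\widetilde{\mathcal H}$, $\varphi\star\delta$ is the unique character of $\mathcal H_{CK}$ that coincides with $\varphi$ on nonempty trees, and $\varphi\mapsto\varphi\star\delta$ is a bijection from the characters of $\widetilde{\mathcal H}$ onto the characters of $\mathcal H_{CK}$. 5. The form $\delta$ is a character, and every character $b$ of $\mathcal H_{CK}$ has a unique inverse $b^{*-1}$ for the convolution $*$. If $b$ is a character of $\mathcal H_{CK}$ with $b(\bullet)=1$ and $\widetilde b$ is the character of $\mathcal H$ with $b=\widetilde b\star\delta$, then $b^{*-1}=\widetilde b\star\delta^{*-1}$. Likewise, if $b$ is any character of $\mathcal H_{CK}$ and $\widetilde b$ is the character of $\widetilde{\mathcal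 H}$ with $b=\widetilde b\star\delta$, then $b^{*-1}=\widetilde b\star\delta^{*-1}$. -/

import Mathlib

open scoped TensorProduct

namespace TreeHopf

/-! ### Rooted trees -/

/-- Planar representatives of nonempty finite rooted trees.  `dot` is the one-vertex tree, and
`graft c t` is the tree obtained from `t` by adding one more branch `c` at its root, i.e. by adding
a new edge from the root of `t` to the root of `c`.  So every edge of a tree corresponds to exactly
one occurrence of `graft`. -/
inductive PTree : Type
  | dot : PTree
  | graft (c t : PTree) : PTree

namespace PTree

/-- Isomorphism of rooted trees: the congruence generated by permuting the branches at a vertex. -/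
inductive Iso : PTree → PTree → Prop
  | refl (t : PTree) : Iso t t
  | symm {t u : PTree} : Iso t u → Iso u t
  | trans {t u v : PTree} : Iso t u → Iso u v → Iso t v
  | congr {c c' t t' : PTree} : Iso c c' → Iso t t' → Iso (graft c t) (graft c' t')
  | swap (a b t : PTree) : Iso (graft a (graft b t)) (graft b (graft a t))

instance isoSetoid : Setoid PTree := ⟨Iso, ⟨Iso.refl, Iso.symm, Iso.trans⟩⟩

/-- Identify the roots of two trees: the branches of the result are the branches of both. -/
def merge : PTree → PTree → PTree
  | dot, u => u
  | graft c t, u => graft c (merge t u)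

/-! #### Subforests and contractions -/

/-- A set of edges of `t`: one Boolean for each edge (`true`: the edge belongs to the set).  In
`(b, S, S') : EdgeSet (graft c t)`, the Boolean `b` is about the edge from the root of `t` to the
root of `c`, and `S`, `S'` are the parts of the set inside `c` and `t`.

A spanning subforest of `t` (a partition of the vertices of `t` into subtrees) is the same thing as
the set of edges of its components, and so is a collection of pairwise disjoint subtrees of `t` with
at least one edge each. -/
def EdgeSet : PTree → Type
  | dot => Unit
  | graft c t => Bool × EdgeSet c × EdgeSet t

instance edgeSetFintype : (t : PTree) → Fintype (EdgeSet t)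
  | dot => inferInstanceAs (Fintype Unit)
  | graft c t =>
    letI := edgeSetFintype c
    letI := edgeSetFintype t
    inferInstanceAs (Fintype (Bool × EdgeSet c × EdgeSet t))

/-- The connected component of the root of `t` in the spanning subforest with edge set `S`. -/
def rootComp : (t : PTree) → EdgeSet t → PTree
  | dot, _ => dot
  | graft c t, (true, S, S') => graft (rootComp c S) (rootComp t S')
  | graft _ t, (false, _, S') => rootComp t S'

/-- The connected components not containing the root of `t`. -/
def otherComps : (t : PTree) → EdgeSet t → Multiset PTree
  | dot, _ => 0
  | graft c t, (true, S, S') => otherComps c S + otherComps t S'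
  | graft c t, (false, S, S') => rootComp c S ::ₘ (otherComps c S + otherComps t S')

/-- All connected components of the spanning subforest of `t` with edge set `S`. -/
def comps (t : PTree) (S : EdgeSet t) : Multiset PTree := rootComp t S ::ₘ otherComps t S

/-- The tree obtained from `t` by contracting each edge in `S`, i.e. by contracting each connected
component of the subforest to a vertex. -/
def contract : (t : PTree) → EdgeSet t → PTree
  | dot, _ => dot
  | graft c t, (true, S, S') => merge (contract c S) (contract t S')
  | graft c t, (false, S, S') => graft (contract c S) (contract t S')

/-! #### Admissible cuts -/

/-- Admissible cuts of `t` (including the empty cut, excluding the total cut): sets of edges such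
that each path from the root to a leaf meets the set at most once.  In
`(o, w) : AdmCut (graft c t)`, `o = none` means that the edge from the root of `t` to the root of
`c` is cut (and hence no edge of `c`), `o = some v` means that this edge is not cut and that `c` is
cut along `v`; `w` is the part of the cut inside `t`. -/
def AdmCut : PTree → Type
  | dot => Unit
  | graft c t => Option (AdmCut c) × AdmCut t

instance admCutFintype : (t : PTree) → Fintype (AdmCut t)
  | dot => inferInstanceAs (Fintype Unit)
  | graft c t =>
    letI := admCutFintype c
    letI := admCutFintype t
    inferInstanceAs (Fintype (Option (AdmCut c) × AdmCut t))

/-- The trunk of an admissible cut: the part of the tree that still contains the root. -/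
def trunk : (t : PTree) → AdmCut t → PTree
  | dot, _ => dot
  | graft _ t, (none, w) => trunk t w
  | graft c t, (some v, w) => graft (trunk c v) (trunk t w)

/-- The pruning (crown) of an admissible cut: the forest of all branches that are cut off. -/
def crown : (t : PTree) → AdmCut t → Multiset PTree
  | dot, _ => 0
  | graft c t, (none, w) => c ::ₘ crown t w
  | graft c t, (some v, w) => crown c v + crown t w

end PTree

/-- Isomorphism classes of nonempty (non-planar) rooted trees. -/
def RTree : Type := Quotient PTree.isoSetoid

/-- The isomorphism class of a planar representative. -/
def RTree.mk (t : PTree) : RTree := Quotient.mk _ t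

/-- The one-vertex tree. -/
def RTree.dot : RTree := RTree.mk PTree.dot

namespace PTree

/-! #### Independence of the planar representative -/

theorem mk_eq {t u : PTree} (h : Iso t u) : RTree.mk t = RTree.mk u := Quotient.sound h

theorem iso_of_mk_eq {t u : PTree} (h : RTree.mk t = RTree.mk u) : Iso t u := Quotient.exact h

theorem merge_congr_right (a : PTree) {b b' : PTree} (h : Iso b b') :
    Iso (merge a b) (merge a b') := by
  induction a with
  | dot => exact h
  | graft c t _ ih => exact .congr (.refl c) ih

theorem merge_congr_left {a a' : PTree} (h : Iso a a') (b : PTree) :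
    Iso (merge a b) (merge a' b) := by
  induction h with
  | refl t => exact .refl _
  | symm _ ih => exact .symm ih
  | trans _ _ ih₁ ih₂ => exact .trans ih₁ ih₂
  | congr hc _ _ ih => exact .congr hc ih
  | swap x y t => exact .swap _ _ _

theorem merge_congr {a a' b b' : PTree} (h : Iso a a') (h' : Iso b b') :
    Iso (merge a b) (merge a' b') :=
  .trans (merge_congr_left h b) (merge_congr_right a' h')

theorem merge_graft (a c t : PTree) : Iso (merge a (graft c t)) (graft c (merge a t)) := by
  induction a with
  | dot => exact .refl _
  | graft x a _ ih => exact .trans (.congr (.refl x) ih) (.swap _ _ _)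

theorem merge_left_comm (a b t : PTree) :
    Iso (merge a (merge b t)) (merge b (merge a t)) := by
  induction a with
  | dot => exact .refl _
  | graft x a _ ih => exact .trans (.congr (.refl x) ih) (.symm (merge_graft b x (merge a t)))

theorem exists_edgeSet_equiv {t u : PTree} (h : Iso t u) :
    ∃ e : EdgeSet t ≃ EdgeSet u, ∀ S,
      RTree.mk (rootComp t S) = RTree.mk (rootComp u (e S)) ∧
      (otherComps t S).map RTree.mk = (otherComps u (e S)).map RTree.mk ∧
      RTree.mk (contract t S) = RTree.mk (contract u (e S)) := by
  induction h with
  | refl t => exact ⟨Equiv.refl _, fun S => ⟨rfl, rfl, rfl⟩⟩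
  | symm _ ih =>
    obtain ⟨e, he⟩ := ih
    refine ⟨e.symm, fun S => ?_⟩
    have := he (e.symm S)
    rw [Equiv.apply_symm_apply] at this
    exact ⟨this.1.symm, this.2.1.symm, this.2.2.symm⟩
  | trans _ _ ih₁ ih₂ =>
    obtain ⟨e, he⟩ := ih₁
    obtain ⟨f, hf⟩ := ih₂
    exact ⟨e.trans f, fun S => ⟨(he S).1.trans (hf _).1, (he S).2.1.trans (hf _).2.1,
      (he S).2.2.trans (hf _).2.2⟩⟩
  | congr _ _ ih₁ ih₂ =>
    obtain ⟨e, he⟩ := ih₁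
    obtain ⟨f, hf⟩ := ih₂
    refine ⟨Equiv.prodCongr (Equiv.refl Bool) (Equiv.prodCongr e f), ?_⟩
    rintro ⟨b, S, S'⟩
    obtain ⟨h1, h2, h3⟩ := he S
    obtain ⟨h1', h2', h3'⟩ := hf S'
    cases b
    · refine ⟨h1', ?_, mk_eq (.congr (iso_of_mk_eq h3) (iso_of_mk_eq h3'))⟩
      change Multiset.map RTree.mk (_ ::ₘ (_ + _)) = Multiset.map RTree.mk (_ ::ₘ (_ + _))
      rw [Multiset.map_cons, Multiset.map_cons, Multiset.map_add, Multiset.map_add, h1, h2, h2']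
    · refine ⟨mk_eq (.congr (iso_of_mk_eq h1) (iso_of_mk_eq h1')), ?_,
        mk_eq (merge_congr (iso_of_mk_eq h3) (iso_of_mk_eq h3'))⟩
      change Multiset.map RTree.mk (_ + _) = Multiset.map RTree.mk (_ + _)
      rw [Multiset.map_add, Multiset.map_add, h2, h2']
  | swap a b t =>
    refine ⟨⟨fun S => (S.2.2.1, S.2.2.2.1, S.1, S.2.1, S.2.2.2.2),
      fun S => (S.2.2.1, S.2.2.2.1, S.1, S.2.1, S.2.2.2.2), fun _ => rfl, fun _ => rfl⟩, ?_⟩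
    rintro ⟨x, S, y, S', S''⟩
    cases x <;> cases y
    · refine ⟨rfl, congrArg _ ?_, mk_eq (.swap _ _ _)⟩
      change rootComp a S ::ₘ (otherComps a S + rootComp b S' ::ₘ (otherComps b S' + _)) =
        rootComp b S' ::ₘ (otherComps b S' + rootComp a S ::ₘ (otherComps a S + _))
      simp only [Multiset.add_cons]
      rw [Multiset.cons_swap, add_left_comm]
    · refine ⟨rfl, congrArg _ ?_, mk_eq (.symm (merge_graft _ _ _))⟩
      change rootComp a S ::ₘ (otherComps a S + (otherComps b S' + _)) =
        otherComps b S' + rootComp a S ::ₘ (otherComps a S + _)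
      simp only [Multiset.add_cons]
      rw [add_left_comm]
    · refine ⟨rfl, congrArg _ ?_, mk_eq (merge_graft _ _ _)⟩
      change otherComps a S + rootComp b S' ::ₘ (otherComps b S' + _) =
        rootComp b S' ::ₘ (otherComps b S' + (otherComps a S + _))
      simp only [Multiset.add_cons]
      rw [add_left_comm]
    · refine ⟨mk_eq (.swap _ _ _), congrArg _ ?_, mk_eq (merge_left_comm _ _ _)⟩
      exact add_left_comm _ _ _

theorem exists_admCut_equiv {t u : PTree} (h : Iso t u) :
    ∃ e : AdmCut t ≃ AdmCut u, ∀ w,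
      RTree.mk (trunk t w) = RTree.mk (trunk u (e w)) ∧
      (crown t w).map RTree.mk = (crown u (e w)).map RTree.mk := by
  induction h with
  | refl t => exact ⟨Equiv.refl _, fun S => ⟨rfl, rfl⟩⟩
  | symm _ ih =>
    obtain ⟨e, he⟩ := ih
    refine ⟨e.symm, fun S => ?_⟩
    have := he (e.symm S)
    rw [Equiv.apply_symm_apply] at this
    exact ⟨this.1.symm, this.2.symm⟩
  | trans _ _ ih₁ ih₂ =>
    obtain ⟨e, he⟩ := ih₁
    obtain ⟨f, hf⟩ := ih₂
    exact ⟨e.trans f, fun S => ⟨(he S).1.trans (hf _).1, (he S).2.trans (hf _).2⟩⟩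
  | congr hc _ ih₁ ih₂ =>
    obtain ⟨e, he⟩ := ih₁
    obtain ⟨f, hf⟩ := ih₂
    refine ⟨Equiv.prodCongr (Equiv.optionCongr e) f, ?_⟩
    rintro ⟨_ | v, w⟩
    · refine ⟨(hf w).1, ?_⟩
      change Multiset.map RTree.mk (_ ::ₘ _) = Multiset.map RTree.mk (_ ::ₘ _)
      rw [Multiset.map_cons, Multiset.map_cons, mk_eq hc, (hf w).2]
    · refine ⟨mk_eq (.congr (iso_of_mk_eq (he v).1) (iso_of_mk_eq (hf w).1)), ?_⟩
      change Multiset.map RTree.mk (_ + _) = Multiset.map RTree.mk (_ + _)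
      rw [Multiset.map_add, Multiset.map_add, (he v).2, (hf w).2]
  | swap a b t =>
    refine ⟨⟨fun S => (S.2.1, S.1, S.2.2), fun S => (S.2.1, S.1, S.2.2),
      fun _ => rfl, fun _ => rfl⟩, ?_⟩
    rintro ⟨_ | v, _ | v', w⟩
    · exact ⟨rfl, congrArg _ (Multiset.cons_swap _ _ _)⟩
    · exact ⟨rfl, congrArg _ (Multiset.add_cons _ _ _).symm⟩
    · exact ⟨rfl, congrArg _ (Multiset.add_cons _ _ _)⟩
    · exact ⟨mk_eq (.swap _ _ _), congrArg _ (add_left_comm _ _ _)⟩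

end PTree

/-! ### The algebras -/

noncomputable section

variable (k : Type*) [Field k]

/-- The Connes-Kreimer algebra of rooted forests: the free commutative algebra on the nonempty
rooted trees.  Its basis of monomials consists of the rooted forests, and `1` is the empty forest. -/
abbrev HCK : Type _ := MvPolynomial RTree k

/-- The algebra underlying the rooted tree bialgebra `H̃`: the free commutative algebra on all
nonempty rooted trees. -/
abbrev HTilde : Type _ := MvPolynomial RTree k

/-- The algebra underlying the rooted tree Hopf algebra `H`: the free commutative algebra on the
rooted trees with at least one edge.  Its unit is identified with the one-vertex tree. -/
abbrev H : Type _ := MvPolynomial {t : RTree // t ≠ RTree.dot} k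

variable {k}

/-- A rooted tree as an element of the Connes-Kreimer algebra. -/
def HCK.tree (t : RTree) : HCK k := MvPolynomial.X t

/-- A rooted tree as an element of `H̃`. -/
def HTilde.tree (t : RTree) : HTilde k := MvPolynomial.X t

open Classical in
/-- A nonempty rooted tree as an element of `H`; the one-vertex tree is the unit of `H`. -/
def H.tree (t : RTree) : H k := if h : t = RTree.dot then 1 else MvPolynomial.X ⟨t, h⟩

/-! ### Coproduct and coactions -/

/-- `∑ s ⊗ t/s` over all subforests `s` of the tree `t`, the components of `s` being viewed in an
algebra `B` through `ι`. -/
def subforestSum {B : Type*} [CommRing B] [Algebra k B] (ι : RTree → B) : RTree → B ⊗[k] HCK k :=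
  Quotient.lift
    (fun t : PTree => ∑ S : t.EdgeSet,
      (((t.comps S).map fun c => ι (RTree.mk c)).prod ⊗ₜ[k] HCK.tree (RTree.mk (t.contract S))))
    (by
      intro t u h
      obtain ⟨e, he⟩ := PTree.exists_edgeSet_equiv h
      refine Fintype.sum_equiv e _ _ fun S => ?_
      obtain ⟨h1, h2, h3⟩ := he S
      have hc : (t.comps S).map RTree.mk = (u.comps (e S)).map RTree.mk := by
        simp only [PTree.comps, Multiset.map_cons, h1, h2]
      have hι := congrArg (fun m => (Multiset.map ι m).prod) hc
      simp only [Multiset.map_map, Function.comp_def] at hι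
      rw [hι, h3])

/-- The left coaction `Φ : H_CK → H ⊗ H_CK`: the algebra morphism with `Φ(t) = ∑ s ⊗ t/s` for each
nonempty tree `t`.  Components of `s` with one vertex are the unit of `H`. -/
def coactH : HCK k →ₐ[k] H k ⊗[k] HCK k := MvPolynomial.aeval (subforestSum H.tree)

/-- The left coaction `H_CK → H̃ ⊗ H_CK`: the algebra morphism with `t ↦ ∑ s ⊗ t/s` for each nonempty
tree `t`, the sum being over the spanning subforests.  Under the identification of the algebras
`H_CK` and `H̃`, this is the coproduct of `H̃`. -/
def coactHTilde : HCK k →ₐ[k] HTilde k ⊗[k] HCK k := MvPolynomial.aeval (subforestSum HTilde.tree)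

/-- `t ⊗ 1 + ∑ P^c(t) ⊗ R^c(t)` over the admissible cuts `c` of `t` (the empty cut gives the term
`1 ⊗ t`, and `t ⊗ 1` is the term of the total cut). -/
def cutSum : RTree → HCK k ⊗[k] HCK k :=
  Quotient.lift
    (fun t : PTree => HCK.tree (RTree.mk t) ⊗ₜ[k] 1 + ∑ w : t.AdmCut,
      (((t.crown w).map fun c => HCK.tree (RTree.mk c)).prod ⊗ₜ[k] HCK.tree (RTree.mk (t.trunk w))))
    (by
      intro t u h
      obtain ⟨e, he⟩ := PTree.exists_admCut_equiv h
      refine congrArg₂ (· + ·) (by rw [PTree.mk_eq h]) (Fintype.sum_equiv e _ _ fun w => ?_)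
      obtain ⟨h1, h2⟩ := he w
      have hι := congrArg (fun m => (Multiset.map (HCK.tree (k := k)) m).prod) h2
      simp only [Multiset.map_map, Function.comp_def] at hι
      rw [hι, h1])

/-- The Connes-Kreimer coproduct. -/
def coprodCK : HCK k →ₐ[k] HCK k ⊗[k] HCK k := MvPolynomial.aeval cutSum

/-! ### Linear forms -/

/-- Characters: unital algebra morphisms to the ground field. -/
def IsCharacter {A : Type*} [CommRing A] [Algebra k A] (f : A →ₗ[k] k) : Prop :=
  f 1 = 1 ∧ ∀ x y, f (x * y) = f x * f y

/-- The counit of the Connes-Kreimer Hopf algebra: the coefficient of the empty forest. -/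
def counitCK : HCK k →ₗ[k] k := MvPolynomial.lcoeff k 0

/-- Infinitesimal characters of the Connes-Kreimer Hopf algebra. -/
def IsInfChar (f : HCK k →ₗ[k] k) : Prop :=
  ∀ x y, f (x * y) = f x * counitCK y + counitCK x * f y

/-- The convolution product `f * g` on linear forms on the Connes-Kreimer Hopf algebra. -/
def convCK (f g : HCK k →ₗ[k] k) : HCK k →ₗ[k] k :=
  LinearMap.mul' k k ∘ₗ TensorProduct.map f g ∘ₗ coprodCK.toLinearMap

/-- `g` is the inverse `f^{*-1}` of `f` for the convolution product. -/
def IsConvInv (f g : HCK k →ₗ[k] k) : Prop :=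
  convCK f g = counitCK ∧ convCK g f = counitCK

/-- The left action `φ ⋆ b = (φ ⊗ b) ∘ Φ` of linear forms on `H` on linear forms on `H_CK`. -/
def starH (φ : H k →ₗ[k] k) (b : HCK k →ₗ[k] k) : HCK k →ₗ[k] k :=
  LinearMap.mul' k k ∘ₗ TensorProduct.map φ b ∘ₗ coactH.toLinearMap

/-- The left action `φ ⋆ b` of linear forms on `H̃` on linear forms on `H_CK`. -/
def starHTilde (φ : HTilde k →ₗ[k] k) (b : HCK k →ₗ[k] k) : HCK k →ₗ[k] k :=
  LinearMap.mul' k k ∘ₗ TensorProduct.map φ b ∘ₗ coactHTilde.toLinearMap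

variable (k)

/-- The element `δ_•` of the dual basis of the forest basis: the coefficient of the forest `•`. -/
def deltaDot : HCK k →ₗ[k] k := MvPolynomial.lcoeff k (Finsupp.single RTree.dot 1)

open Classical in
/-- The character `δ` with `δ(•) = 1` and `δ(t) = 0` for any other nonempty tree `t`. -/
def deltaChar : HCK k →ₗ[k] k :=
  (MvPolynomial.aeval fun t : RTree => if t = RTree.dot then (1 : k) else 0).toLinearMap

end

end TreeHopf

/-!
A weight `w` on trees, extended multiplicatively to forests, defines an algebra endomorphism `L_w`
of `H_CK` by `t ↦ ∑ w(s) t/s`, the sum running over the spanning subforests `s` of `t`, and acting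
by a character `φ` amounts to composing with `L_w`, where `w` is the restriction of `φ` to trees.
Only the subforest `s = t` contracts `t` to `•`, so that `δ ∘ L_w` and `δ_• ∘ L_w` both take the
value `w t` on `t`, and (infinitesimal) characters are determined by their values on trees.

Moreover `L_w` is a morphism of coalgebras: a subforest of `t` together with a cut of the
contraction is the same thing as a cut of `t` together with subforests of its crown and its trunk.
Hence the action of `φ` preserves convolution inverses, and every character `δ ∘ L_w` has an
inverse because `δ` has the inverse `t ↦ (-1)^|t|`.
-/

namespace TreeHopf

namespace PTree

section Cuts

variable {A : Type*} [CommSemiring A]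

/-- The sum `∑ x(P^c(t)) f(R^c(t))` over the admissible cuts `c` of the tree `t`, where `x` is
extended multiplicatively to forests. -/
def sumCuts (x f : PTree → A) (t : PTree) : A :=
  ∑ w : t.AdmCut, ((t.crown w).map x).prod * f (t.trunk w)

theorem sumCuts_dot (x f : PTree → A) : sumCuts x f dot = f dot :=
  (Fintype.sum_unique (ι := Unit) _).trans (by simp [crown, trunk])

theorem sumCuts_graft (x f : PTree → A) (c t : PTree) :
    sumCuts x f (graft c t) =
      x c * sumCuts x f t + sumCuts x (fun u => sumCuts x (fun v => f (graft u v)) t) c := by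
  refine ((Fintype.sum_prod_type (α₁ := Option c.AdmCut) (α₂ := t.AdmCut) _).trans
    (Fintype.sum_option _)).trans ?_
  simp only [sumCuts, crown, trunk, Multiset.map_cons, Multiset.prod_cons, Multiset.map_add,
    Multiset.prod_add, Finset.mul_sum, mul_assoc]

theorem sumCuts_sum_mul {ι : Type*} [Fintype ι] (x : PTree → A) (a : ι → A) (f : ι → PTree → A)
    (t : PTree) :
    sumCuts x (fun u => ∑ i, a i * f i u) t = ∑ i, a i * sumCuts x (f i) t := by
  simp only [sumCuts, Finset.mul_sum, mul_left_comm (a _)]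
  exact Finset.sum_comm

theorem sumCuts_const_mul (x : PTree → A) (a : A) (f : PTree → A) (t : PTree) :
    sumCuts x (fun u => a * f u) t = a * sumCuts x f t := by
  simpa using sumCuts_sum_mul x (fun _ : Unit => a) (fun _ => f) t

theorem sumCuts_mul_const (x : PTree → A) (f : PTree → A) (a : A) (t : PTree) :
    sumCuts x (fun u => f u * a) t = sumCuts x f t * a := by
  simp only [mul_comm _ a, sumCuts_const_mul]

theorem sumCuts_add (x f g : PTree → A) (t : PTree) :
    sumCuts x (fun u => f u + g u) t = sumCuts x f t + sumCuts x g t := by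
  simp only [sumCuts, mul_add, Finset.sum_add_distrib]

theorem sumCuts_comm (x y : PTree → A) (f : PTree → PTree → A) (s t : PTree) :
    sumCuts x (fun u => sumCuts y (f u) t) s = sumCuts y (fun v => sumCuts x (f · v) s) t :=
  sumCuts_sum_mul x _ _ s

theorem sumCuts_merge (x f : PTree → A) (s t : PTree) :
    sumCuts x f (merge s t) = sumCuts x (fun u => sumCuts x (fun v => f (merge u v)) t) s := by
  induction s generalizing f with
  | dot => rw [sumCuts_dot]; rfl
  | graft c s _ ih => simp only [merge, sumCuts_graft, ih]

theorem sumCuts_zero_left (f : PTree → A) (t : PTree) : sumCuts 0 f t = f t := by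
  induction t generalizing f with
  | dot => exact sumCuts_dot 0 f
  | graft c t ihc iht => simp only [sumCuts_graft, Pi.zero_apply, zero_mul, zero_add, ihc, iht]

theorem sumCuts_zero_right (x : PTree → A) (t : PTree) : sumCuts x (fun _ => 0) t = 0 := by
  simp [sumCuts]

/-- Cutting `t` twice amounts to cutting it along the lower cut first and distributing what falls
off: each pruned branch is either taken off whole or cut once more. -/
theorem sumCuts_sumCuts (x y f : PTree → A) (t : PTree) :
    sumCuts x (sumCuts y f) t = sumCuts (x + sumCuts x y) f t := by
  induction t generalizing f with
  | dot => simp only [sumCuts_dot]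
  | graft c t ihc iht =>
    have cut_both : sumCuts x (fun u => sumCuts x (fun v => sumCuts y (fun u' =>
          sumCuts y (fun v' => f (graft u' v')) v) u) t) c =
        sumCuts (x + sumCuts x y)
          (fun u => sumCuts (x + sumCuts x y) (fun v => f (graft u v)) t) c := by
      simp only [← iht, ← ihc]
      congr! 2 with u
      exact sumCuts_comm x y _ t u
    calc sumCuts x (sumCuts y f) (graft c t)
      _ = x c * sumCuts x (sumCuts y f) t + (sumCuts x y c * sumCuts x (sumCuts y f) t +
            sumCuts x (fun u => sumCuts x (fun v => sumCuts y (fun u' =>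
              sumCuts y (fun v' => f (graft u' v')) v) u) t) c) := by
        simp only [sumCuts_graft, sumCuts_add, sumCuts_const_mul, sumCuts_mul_const]
      _ = sumCuts (x + sumCuts x y) f (graft c t) := by
        rw [cut_both, iht, sumCuts_graft, Pi.add_apply, add_mul, add_assoc]

end Cuts

section Subforests

variable {A : Type*} [CommSemiring A]

/-- The sum `∑ p(s') f(r, t/s)` over the spanning subforests `s` of the tree `t`, where `r` is the
component of the root in `s` and `p` is extended multiplicatively to the forest `s'` of the other
components. -/
def sumSubforests (p : PTree → A) (f : PTree → PTree → A) (t : PTree) : A :=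
  ∑ S : t.EdgeSet, ((t.otherComps S).map p).prod * f (t.rootComp S) (t.contract S)

/-- The sum `∑ p(s) f(t/s)` over the spanning subforests `s` of the tree `t`, where `p` is extended
multiplicatively to forests. -/
def sumContractions (p f : PTree → A) : PTree → A := sumSubforests p fun r u => p r * f u

theorem sumContractions_eq_sum (p f : PTree → A) (t : PTree) :
    sumContractions p f t = ∑ S : t.EdgeSet, ((t.comps S).map p).prod * f (t.contract S) := by
  simp only [sumContractions, sumSubforests, comps, Multiset.map_cons, Multiset.prod_cons,
    mul_left_comm, mul_assoc]

theorem sumSubforests_dot (p : PTree → A) (f : PTree → PTree → A) :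
    sumSubforests p f dot = f dot dot :=
  (Fintype.sum_unique (ι := Unit) _).trans (by simp [otherComps, rootComp, contract])

theorem sumSubforests_graft (p : PTree → A) (f : PTree → PTree → A) (c t : PTree) :
    sumSubforests p f (graft c t) =
      sumSubforests p (fun r u => p r * sumSubforests p (fun q v => f q (graft u v)) t) c +
      sumSubforests p (fun r u => sumSubforests p (fun q v => f (graft r q) (merge u v)) t) c := by
  refine (Fintype.sum_prod_type (α₁ := Bool) (α₂ := c.EdgeSet × t.EdgeSet) _).trans ?_
  rw [Fintype.sum_bool, Fintype.sum_prod_type, Fintype.sum_prod_type, add_comm]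
  simp only [sumSubforests, otherComps, rootComp, contract, Multiset.map_cons,
    Multiset.prod_cons, Multiset.map_add, Multiset.prod_add, Finset.mul_sum, mul_assoc,
    mul_left_comm (p _)]

theorem sumSubforests_add (p : PTree → A) (f g : PTree → PTree → A) (t : PTree) :
    sumSubforests p (fun r u => f r u + g r u) t = sumSubforests p f t + sumSubforests p g t := by
  simp only [sumSubforests, mul_add, Finset.sum_add_distrib]

theorem sumSubforests_const_mul (p : PTree → A) (a : A) (f : PTree → PTree → A) (t : PTree) :
    sumSubforests p (fun r u => a * f r u) t = a * sumSubforests p f t := by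
  simp only [sumSubforests, Finset.mul_sum, mul_left_comm a]

theorem sumSubforests_mul_const (p : PTree → A) (f : PTree → PTree → A) (a : A) (t : PTree) :
    sumSubforests p (fun r u => f r u * a) t = sumSubforests p f t * a := by
  simp only [mul_comm _ a, sumSubforests_const_mul]

theorem sumSubforests_zero (p : PTree → A) (t : PTree) : sumSubforests p (fun _ _ => 0) t = 0 := by
  simp [sumSubforests]

theorem sumCuts_sumSubforests_comm (x p : PTree → A) (f : PTree → PTree → PTree → A)
    (s t : PTree) :
    sumCuts x (fun u => sumSubforests p (f u) t) s =
      sumSubforests p (fun r v => sumCuts x (f · r v) s) t :=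
  sumCuts_sum_mul x _ _ s

/-- A subforest `s` of `t` with a cut of `t/s` is the same thing as a cut of `t`, through the
corresponding edges outside `s`, with a subforest of the crown and of the trunk. Keeping track of
the component of the root is what makes the induction go through. -/
theorem sumSubforests_sumCuts (p f : PTree → A) (h : PTree → PTree → A) (t : PTree) :
    sumSubforests p (fun r => sumCuts f (h r)) t =
      sumCuts (sumContractions p f) (sumSubforests p h) t := by
  induction t generalizing h with
  | dot => simp only [sumCuts_dot, sumSubforests_dot]
  | graft c t ihc iht =>
    have interchange (G : PTree → PTree → PTree → PTree → A) :
        sumSubforests p (fun r u => sumSubforests p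
          (fun q v => sumCuts f (fun u' => sumCuts f (G r u' q) v) u) t) c =
        sumCuts (sumContractions p f) (fun u => sumCuts (sumContractions p f)
          (fun v => sumSubforests p (fun r u' => sumSubforests p (G r u') v) u) t) c := by
      simp only [← sumCuts_sumSubforests_comm, iht]
      rw [ihc fun r u => sumCuts (sumContractions p f) (sumSubforests p (G r u)) t]
      congr! 2 with u
      exact (sumCuts_sumSubforests_comm _ p _ t u).symm
    have root_edge_outside : sumSubforests p (fun r u => p r * sumSubforests p
          (fun q v => sumCuts f (h q) (graft u v)) t) c =
        sumContractions p f c * sumCuts (sumContractions p f) (sumSubforests p h) t +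
          sumCuts (sumContractions p f) (fun u => sumCuts (sumContractions p f) (fun v =>
            sumSubforests p (fun r u' => p r * sumSubforests p
              (fun q v' => h q (graft u' v')) v) u) t) c := by
      simp only [← sumSubforests_const_mul, ← interchange]
      simp only [sumCuts_graft, sumCuts_const_mul, sumSubforests_add, sumSubforests_const_mul,
        mul_add, iht, sumContractions, ← mul_assoc, sumSubforests_mul_const]
    have root_edge_inside : sumSubforests p (fun r u => sumSubforests p
          (fun q v => sumCuts f (h (graft r q)) (merge u v)) t) c =
        sumCuts (sumContractions p f) (fun u => sumCuts (sumContractions p f) (fun v =>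
          sumSubforests p (fun r u' => sumSubforests p
            (fun q v' => h (graft r q) (merge u' v')) v) u) t) c := by
      simp only [sumCuts_merge, ← interchange]
    rw [sumSubforests_graft, root_edge_outside, root_edge_inside, sumCuts_graft, add_assoc]
    simp only [sumSubforests_graft, sumCuts_add]

theorem sumContractions_add (p f g : PTree → A) :
    sumContractions p (f + g) = sumContractions p f + sumContractions p g := by
  ext t
  simp only [sumContractions, Pi.add_apply, mul_add, sumSubforests_add]

theorem sumContractions_sumCuts (p f g : PTree → A) :
    sumContractions p (sumCuts f g) = sumCuts (sumContractions p f) (sumContractions p g) := by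
  ext t
  simp only [sumContractions, ← sumCuts_const_mul]
  exact sumSubforests_sumCuts p f (fun r u => p r * g u) t

theorem merge_eq_dot {s t : PTree} : merge s t = dot ↔ s = dot ∧ t = dot := by
  cases s <;> simp [merge]

open Classical in
theorem sumSubforests_ite_contract_eq_dot (p g : PTree → A) (t : PTree) :
    sumSubforests p (fun r u => if u = dot then g r else 0) t = g t := by
  induction t generalizing g with
  | dot => simp [sumSubforests_dot]
  | graft c t ihc iht =>
    have pull_out (r u : PTree) :
        sumSubforests p (fun q v => if u = dot then if v = dot then g (graft r q) else 0 else 0) t =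
          if u = dot then g (graft r t) else 0 := by
      split_ifs
      · exact iht fun q => g (graft r q)
      · exact sumSubforests_zero p t
    simp only [sumSubforests_graft, reduceCtorEq, if_false, sumSubforests_zero, mul_zero, zero_add,
      merge_eq_dot, ite_and, pull_out]
    exact ihc fun r => g (graft r t)

open Classical in
theorem sumContractions_ite_eq_dot (p : PTree → A) (t : PTree) :
    sumContractions p (fun u => if u = dot then 1 else 0) t = p t := by
  simp only [sumContractions, mul_ite, mul_one, mul_zero, sumSubforests_ite_contract_eq_dot]

end Subforests

section Vertices

/-- The number of vertices `|t|` of a tree. -/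
def numVertices : PTree → ℕ
  | dot => 1
  | graft c t => numVertices c + numVertices t

theorem Iso.numVertices_eq {t u : PTree} (h : Iso t u) : numVertices t = numVertices u := by
  induction h with
  | refl => rfl
  | symm _ ih => exact ih.symm
  | trans _ _ ih₁ ih₂ => exact ih₁.trans ih₂
  | congr _ _ ih₁ ih₂ => rw [numVertices, numVertices, ih₁, ih₂]
  | swap => exact Nat.add_left_comm _ _ _

theorem Iso.eq_dot_iff {t u : PTree} (h : Iso t u) : t = dot ↔ u = dot := by
  induction h with
  | refl => rfl
  | symm _ ih => exact ih.symm
  | trans _ _ ih₁ ih₂ => exact ih₁.trans ih₂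
  | congr => simp
  | swap => simp

theorem mk_eq_dot_iff {t : PTree} : RTree.mk t = RTree.dot ↔ t = dot :=
  ⟨fun h => (iso_of_mk_eq h).eq_dot_iff.2 rfl, fun h => h ▸ rfl⟩

variable {A : Type*} [CommRing A]

open Classical in
theorem sumCuts_sign_dot (t : PTree) :
    sumCuts (fun c => (-1 : A) ^ numVertices c) (fun r => if r = dot then 1 else 0) t =
      -(-1) ^ numVertices t := by
  induction t with
  | dot => simp [sumCuts_dot, numVertices]
  | graft c t _ iht =>
    simp only [sumCuts_graft, iht, reduceCtorEq, if_false, sumCuts_zero_right, numVertices,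
      pow_add, mul_neg, add_zero]

open Classical in
theorem sumCuts_dot_sign (t : PTree) :
    sumCuts (fun c => if c = dot then (1 : A) else 0) (fun r => (-1) ^ numVertices r) t =
      if t = dot then -1 else 0 := by
  induction t with
  | dot => simp [sumCuts_dot, numVertices]
  | graft c t ihc _ =>
    simp only [sumCuts_graft, numVertices, pow_add, sumCuts_const_mul, sumCuts_mul_const, ihc,
      reduceCtorEq, if_false]
    split_ifs <;> simp

end Vertices

end PTree

/-- The number of vertices `|t|` of a tree. -/
def RTree.numVertices : RTree → ℕ := Quotient.lift PTree.numVertices fun _ _ h => h.numVertices_eq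

theorem RTree.mk_surjective : Function.Surjective RTree.mk := Quotient.mk_surjective

noncomputable section

variable {k : Type*} [Field k]

theorem algHom_ext_tree {A : Type*} [Semiring A] [Algebra k A] {x y : HCK k →ₐ[k] A}
    (h : ∀ t : PTree, x (HCK.tree (RTree.mk t)) = y (HCK.tree (RTree.mk t))) : x = y :=
  MvPolynomial.algHom_ext (RTree.mk_surjective.forall.2 h)

theorem map_coprodCK_tree {A : Type*} [CommSemiring A] [Algebra k A]
    (Ψ : HCK k ⊗[k] HCK k →ₐ[k] A) (t : PTree) :
    Ψ (coprodCK (k := k) (HCK.tree (RTree.mk t))) = Ψ (HCK.tree (RTree.mk t) ⊗ₜ 1) +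
      PTree.sumCuts (fun c => Ψ (HCK.tree (RTree.mk c) ⊗ₜ 1))
        (fun r => Ψ (1 ⊗ₜ HCK.tree (RTree.mk r))) t := by
  have coprod_tree : coprodCK (k := k) (HCK.tree (RTree.mk t)) = cutSum (RTree.mk t) :=
    MvPolynomial.aeval_X _ _
  have crown_tmul_trunk (m : Multiset (HCK k)) (r : HCK k) :
      Ψ (m.prod ⊗ₜ r) = (m.map fun c => Ψ (c ⊗ₜ 1)).prod * Ψ (1 ⊗ₜ r) := by
    have prod_tmul_one : Ψ (m.prod ⊗ₜ 1) = (m.map fun c => Ψ (c ⊗ₜ 1)).prod :=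
      map_multiset_prod (Ψ.comp Algebra.TensorProduct.includeLeft) m
    rw [← prod_tmul_one, ← map_mul, Algebra.TensorProduct.tmul_mul_tmul, mul_one, one_mul]
  rw [coprod_tree]
  refine (map_add Ψ _ _).trans (congrArg _ ((map_sum Ψ _ _).trans ?_))
  simp only [crown_tmul_trunk, Multiset.map_map, Function.comp_def, PTree.sumCuts]

theorem isCharacter_toLinearMap {A : Type*} [CommRing A] [Algebra k A] (x : A →ₐ[k] k) :
    IsCharacter x.toLinearMap :=
  ⟨map_one x, map_mul x⟩

theorem IsCharacter.exists_algHom {A : Type*} [CommRing A] [Algebra k A] {f : A →ₗ[k] k}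
    (h : IsCharacter f) : ∃ x : A →ₐ[k] k, x.toLinearMap = f :=
  ⟨AlgHom.ofLinearMap f h.1 h.2, rfl⟩

theorem isCharacter_counitCK : IsCharacter (counitCK : HCK k →ₗ[k] k) :=
  ⟨map_one MvPolynomial.constantCoeff, map_mul MvPolynomial.constantCoeff⟩

theorem counitCK_tree (t : RTree) : counitCK (HCK.tree t : HCK k) = 0 :=
  MvPolynomial.constantCoeff_X k t

theorem coprodCK_coassoc :
    (Algebra.TensorProduct.assoc k k k (HCK k) (HCK k) (HCK k)).toAlgHom.comp
        ((Algebra.TensorProduct.map (coprodCK (k := k)) (.id k (HCK k))).comp coprodCK) =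
      (Algebra.TensorProduct.map (.id k (HCK k)) (coprodCK (k := k))).comp coprodCK := by
  refine algHom_ext_tree fun t => ?_
  let assoc := (Algebra.TensorProduct.assoc k k k (HCK k) (HCK k) (HCK k)).toAlgHom
  let x (u : PTree) : HCK k ⊗[k] (HCK k ⊗[k] HCK k) := HCK.tree (RTree.mk u) ⊗ₜ (1 ⊗ₜ 1)
  let y (u : PTree) : HCK k ⊗[k] (HCK k ⊗[k] HCK k) := 1 ⊗ₜ (HCK.tree (RTree.mk u) ⊗ₜ 1)
  let z (u : PTree) : HCK k ⊗[k] (HCK k ⊗[k] HCK k) := 1 ⊗ₜ (1 ⊗ₜ HCK.tree (RTree.mk u))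
  have map_coprod (Ψ : HCK k ⊗[k] HCK k →ₐ[k] HCK k ⊗[k] (HCK k ⊗[k] HCK k)) (u : PTree) :=
    map_coprodCK_tree (k := k) (A := HCK k ⊗[k] (HCK k ⊗[k] HCK k)) Ψ u
  have coprod_left (u : PTree) :
      assoc (coprodCK (k := k) (HCK.tree (RTree.mk u)) ⊗ₜ 1) = x u + PTree.sumCuts x y u :=
    map_coprod (assoc.comp Algebra.TensorProduct.includeLeft) u
  have coprod_right (u : PTree) :
      1 ⊗ₜ coprodCK (k := k) (HCK.tree (RTree.mk u)) = y u + PTree.sumCuts y z u :=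
    map_coprod Algebra.TensorProduct.includeRight u
  calc assoc (Algebra.TensorProduct.map coprodCK (.id k (HCK k)) (coprodCK (k := k) _))
    _ = x t + PTree.sumCuts x y t + PTree.sumCuts (x + PTree.sumCuts x y) z t := by
      refine (map_coprod (assoc.comp (Algebra.TensorProduct.map coprodCK (.id k (HCK k))))
        t).trans ?_
      simp only [AlgHom.comp_apply, Algebra.TensorProduct.map_tmul, AlgHom.id_apply, map_one,
        coprod_left]
      rfl
    _ = x t + PTree.sumCuts x (fun u => y u + PTree.sumCuts y z u) t := by
      rw [PTree.sumCuts_add, PTree.sumCuts_sumCuts, add_assoc]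
    _ = Algebra.TensorProduct.map (.id k (HCK k)) coprodCK (coprodCK (k := k) _) := by
      rw [map_coprod (Algebra.TensorProduct.map (.id k (HCK k)) coprodCK)]
      simp only [Algebra.TensorProduct.map_tmul, AlgHom.id_apply, map_one, coprod_right]
      rfl

/-- The counit `counitCK` as an algebra morphism. -/
def counitAlgHomCK : HCK k →ₐ[k] k :=
  AlgHom.ofLinearMap counitCK isCharacter_counitCK.1 isCharacter_counitCK.2

theorem counitAlgHomCK_tree (t : RTree) : counitAlgHomCK (HCK.tree t : HCK k) = 0 :=
  counitCK_tree t

theorem counit_rTensor_coprodCK :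
    (Algebra.TensorProduct.map (counitAlgHomCK (k := k)) (.id k (HCK k))).comp coprodCK =
      (Algebra.TensorProduct.lid k (HCK k)).symm := by
  refine algHom_ext_tree fun t => ?_
  rw [AlgHom.comp_apply, map_coprodCK_tree (k := k) (A := k ⊗[k] HCK k)]
  simp only [Algebra.TensorProduct.map_tmul, counitAlgHomCK_tree, TensorProduct.zero_tmul, zero_add,
    map_one]
  exact PTree.sumCuts_zero_left _ t

theorem counit_lTensor_coprodCK :
    (Algebra.TensorProduct.map (.id k (HCK k)) (counitAlgHomCK (k := k))).comp coprodCK =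
      (Algebra.TensorProduct.rid k k (HCK k)).symm := by
  refine algHom_ext_tree fun t => ?_
  rw [AlgHom.comp_apply, map_coprodCK_tree (k := k) (A := HCK k ⊗[k] k)]
  simp only [Algebra.TensorProduct.map_tmul, counitAlgHomCK_tree, TensorProduct.tmul_zero,
    PTree.sumCuts_zero_right, add_zero, map_one]
  rfl

/-- The coalgebra structure of the Connes-Kreimer algebra given by admissible cuts. It is only a
local instance, because `MvPolynomial` already carries the coalgebra structure of a monoid algebra,
in which the monomials are group-like. -/
abbrev connesKreimerCoalgebra : Coalgebra k (HCK k) where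
  comul := coprodCK.toLinearMap
  counit := counitCK
  coassoc := congrArg AlgHom.toLinearMap coprodCK_coassoc
  rTensor_counit_comp_comul := congrArg AlgHom.toLinearMap counit_rTensor_coprodCK
  lTensor_counit_comp_comul := congrArg AlgHom.toLinearMap counit_lTensor_coprodCK

attribute [local instance] connesKreimerCoalgebra

theorem IsConvInv.unique {f g g' : HCK k →ₗ[k] k} (h : IsConvInv f g) (h' : IsConvInv f g') :
    g = g' :=
  WithConv.toConv_injective (left_inv_eq_right_inv
    (congrArg WithConv.toConv h.2) (congrArg WithConv.toConv h'.1))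

theorem convCK_comp_coalgHom (f g : HCK k →ₗ[k] k) (L : HCK k →ₗc[k] HCK k) :
    convCK (f ∘ₗ L.toLinearMap) (g ∘ₗ L.toLinearMap) = convCK f g ∘ₗ L.toLinearMap :=
  (LinearMap.convMul_comp_coalgHom_distrib (.toConv f) (.toConv g) L).symm

theorem IsConvInv.comp_coalgHom {f g : HCK k →ₗ[k] k} (h : IsConvInv f g)
    (L : HCK k →ₗc[k] HCK k) : IsConvInv (f ∘ₗ L.toLinearMap) (g ∘ₗ L.toLinearMap) := by
  rw [IsConvInv, convCK_comp_coalgHom, convCK_comp_coalgHom, h.1, h.2]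
  exact ⟨L.counit_comp, L.counit_comp⟩

theorem convCK_toLinearMap_tree (x y : HCK k →ₐ[k] k) (t : PTree) :
    convCK x.toLinearMap y.toLinearMap (HCK.tree (RTree.mk t)) = x (HCK.tree (RTree.mk t)) +
      PTree.sumCuts (fun c => x (HCK.tree (RTree.mk c)))
        (fun r => y (HCK.tree (RTree.mk r))) t := by
  refine (map_coprodCK_tree ((Algebra.TensorProduct.lmul' k).comp
    (Algebra.TensorProduct.map x y)) t).trans ?_
  simp

theorem isCharacter_convCK {f g : HCK k →ₗ[k] k} (hf : IsCharacter f) (hg : IsCharacter g) :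
    IsCharacter (convCK f g) := by
  obtain ⟨x, rfl⟩ := hf.exists_algHom
  obtain ⟨y, rfl⟩ := hg.exists_algHom
  exact isCharacter_toLinearMap (((Algebra.TensorProduct.lmul' k).comp
    (Algebra.TensorProduct.map x y)).comp coprodCK)

/-- The endomorphism `t ↦ ∑ w(s) t/s` of the Connes-Kreimer algebra, where `s` runs over the
spanning subforests of the tree `t` and the weight `w` is extended multiplicatively to forests. -/
def contractAlgHom (w : RTree → k) : HCK k →ₐ[k] HCK k :=
  (Algebra.TensorProduct.lid k (HCK k)).toAlgHom.comp (MvPolynomial.aeval (subforestSum w))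

theorem map_contractAlgHom_tree {A : Type*} [CommSemiring A] [Algebra k A] (f : HCK k →ₗ[k] A)
    (w : RTree → k) (t : PTree) :
    f (contractAlgHom w (HCK.tree (RTree.mk t))) =
      PTree.sumContractions (fun c => algebraMap k A (w (RTree.mk c)))
        (fun u => f (HCK.tree (RTree.mk u))) t := by
  have contract_tree : contractAlgHom w (HCK.tree (RTree.mk t)) =
      Algebra.TensorProduct.lid k (HCK k) (subforestSum w (RTree.mk t)) :=
    congrArg _ (MvPolynomial.aeval_X _ _)
  rw [contract_tree, PTree.sumContractions_eq_sum]
  refine (congrArg f (map_sum _ _ _)).trans ((map_sum f _ _).trans ?_)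
  refine Finset.sum_congr rfl fun S _ => ?_
  rw [Algebra.TensorProduct.lid_tmul, map_smul, Algebra.smul_def, map_multiset_prod,
    Multiset.map_map]
  rfl

theorem counitCK_comp_contractAlgHom (w : RTree → k) :
    counitCK ∘ₗ (contractAlgHom w).toLinearMap = counitCK := by
  refine congrArg AlgHom.toLinearMap (algHom_ext_tree
    (x := counitAlgHomCK.comp (contractAlgHom w)) (y := counitAlgHomCK) fun t => ?_)
  refine (map_contractAlgHom_tree counitCK w t).trans ?_
  simp only [counitCK_tree, PTree.sumContractions, mul_zero, PTree.sumSubforests_zero]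
  exact (counitCK_tree _).symm

theorem coprodCK_comp_contractAlgHom (w : RTree → k) :
    coprodCK.comp (contractAlgHom w) =
      (Algebra.TensorProduct.map (contractAlgHom w) (contractAlgHom w)).comp coprodCK := by
  refine algHom_ext_tree fun t => ?_
  let x (u : PTree) : HCK k ⊗[k] HCK k := HCK.tree (RTree.mk u) ⊗ₜ 1
  let y (u : PTree) : HCK k ⊗[k] HCK k := 1 ⊗ₜ HCK.tree (RTree.mk u)
  let p (u : PTree) : HCK k ⊗[k] HCK k := algebraMap k _ (w (RTree.mk u))
  have coprod_tree (u : PTree) :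
      coprodCK (k := k) (HCK.tree (RTree.mk u)) = (x + PTree.sumCuts x y) u :=
    map_coprodCK_tree (A := HCK k ⊗[k] HCK k) (.id k (HCK k ⊗[k] HCK k)) u
  have contract_tmul_one (u : PTree) :
      contractAlgHom w (HCK.tree (RTree.mk u)) ⊗ₜ 1 = PTree.sumContractions p x u :=
    map_contractAlgHom_tree
      (Algebra.TensorProduct.includeLeft : HCK k →ₐ[k] HCK k ⊗[k] HCK k).toLinearMap w u
  have one_tmul_contract (u : PTree) :
      1 ⊗ₜ contractAlgHom w (HCK.tree (RTree.mk u)) = PTree.sumContractions p y u :=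
    map_contractAlgHom_tree
      (Algebra.TensorProduct.includeRight : HCK k →ₐ[k] HCK k ⊗[k] HCK k).toLinearMap w u
  calc coprodCK (k := k) (contractAlgHom w (HCK.tree (RTree.mk t)))
    _ = PTree.sumContractions p (x + PTree.sumCuts x y) t := by
      refine (map_contractAlgHom_tree (coprodCK (k := k)).toLinearMap w t).trans ?_
      simp only [AlgHom.toLinearMap_apply, coprod_tree]
      rfl
    _ = PTree.sumContractions p x t +
        PTree.sumCuts (PTree.sumContractions p x) (PTree.sumContractions p y) t := by
      rw [PTree.sumContractions_add, PTree.sumContractions_sumCuts, Pi.add_apply]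
    _ = Algebra.TensorProduct.map (contractAlgHom w) (contractAlgHom w)
        (coprodCK (k := k) (HCK.tree (RTree.mk t))) := by
      rw [map_coprodCK_tree (k := k) (A := HCK k ⊗[k] HCK k)]
      simp only [Algebra.TensorProduct.map_tmul, map_one, contract_tmul_one, one_tmul_contract]

/-- `contractAlgHom w` as a morphism of coalgebras. -/
def contractCoalgHom (w : RTree → k) : HCK k →ₗc[k] HCK k where
  __ := (contractAlgHom w).toLinearMap
  counit_comp := counitCK_comp_contractAlgHom w
  map_comp_comul := congrArg AlgHom.toLinearMap (coprodCK_comp_contractAlgHom w).symm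

theorem IsConvInv.comp_contractAlgHom {f g : HCK k →ₗ[k] k} (h : IsConvInv f g) (w : RTree → k) :
    IsConvInv (f ∘ₗ (contractAlgHom w).toLinearMap) (g ∘ₗ (contractAlgHom w).toLinearMap) :=
  h.comp_coalgHom (contractCoalgHom w)

theorem IsCharacter.comp_algHom {A B : Type*} [CommRing A] [Algebra k A] [CommRing B] [Algebra k B]
    {f : B →ₗ[k] k} (hf : IsCharacter f) (L : A →ₐ[k] B) : IsCharacter (f ∘ₗ L.toLinearMap) := by
  obtain ⟨x, rfl⟩ := hf.exists_algHom
  exact isCharacter_toLinearMap (x.comp L)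

theorem IsInfChar.comp_contractAlgHom {f : HCK k →ₗ[k] k} (hf : IsInfChar f) (w : RTree → k) :
    IsInfChar (f ∘ₗ (contractAlgHom w).toLinearMap) := by
  intro x y
  rw [← counitCK_comp_contractAlgHom w]
  exact (congrArg f (map_mul (contractAlgHom w) x y)).trans (hf _ _)

theorem mul_map_subforestSum {B : Type*} [CommRing B] [Algebra k B] (φ : B →ₐ[k] k) (ι : RTree → B)
    (b : HCK k →ₗ[k] k) :
    LinearMap.mul' k k ∘ₗ TensorProduct.map φ.toLinearMap b ∘ₗ
        (MvPolynomial.aeval (subforestSum (k := k) ι)).toLinearMap =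
      b ∘ₗ (contractAlgHom (φ ∘ ι)).toLinearMap := by
  have push_weights : (Algebra.TensorProduct.map φ (.id k (HCK k))).comp
      (MvPolynomial.aeval (subforestSum (k := k) ι)) =
        MvPolynomial.aeval (subforestSum (k := k) (φ ∘ ι)) := by
    refine MvPolynomial.algHom_ext (RTree.mk_surjective.forall.2 fun t => ?_)
    rw [AlgHom.comp_apply, MvPolynomial.aeval_X, MvPolynomial.aeval_X]
    refine (map_sum _ _ _).trans (Finset.sum_congr rfl fun S _ => ?_)
    simp only [Algebra.TensorProduct.map_tmul, map_multiset_prod, Multiset.map_map]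
    rfl
  have evaluate : LinearMap.mul' k k ∘ₗ TensorProduct.map φ.toLinearMap b =
      b ∘ₗ (Algebra.TensorProduct.lid k (HCK k)).toLinearMap ∘ₗ
        (Algebra.TensorProduct.map φ (.id k (HCK k))).toLinearMap :=
    TensorProduct.ext' fun x y => by simp
  rw [← LinearMap.comp_assoc, evaluate, contractAlgHom, ← push_weights]
  rfl

theorem starH_eq {φ : H k →ₗ[k] k} (hφ : IsCharacter φ) (b : HCK k →ₗ[k] k) :
    starH φ b = b ∘ₗ (contractAlgHom fun t => φ (H.tree t)).toLinearMap := by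
  obtain ⟨x, rfl⟩ := hφ.exists_algHom
  exact mul_map_subforestSum x H.tree b

theorem starHTilde_eq {φ : HTilde k →ₗ[k] k} (hφ : IsCharacter φ) (b : HCK k →ₗ[k] k) :
    starHTilde φ b = b ∘ₗ (contractAlgHom fun t => φ (HTilde.tree t)).toLinearMap := by
  obtain ⟨x, rfl⟩ := hφ.exists_algHom
  exact mul_map_subforestSum x HTilde.tree b

open Classical in
theorem deltaChar_tree (t : RTree) :
    deltaChar k (HCK.tree t) = if t = RTree.dot then 1 else 0 :=
  MvPolynomial.aeval_X _ _

open Classical in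
theorem deltaDot_tree (t : RTree) :
    deltaDot k (HCK.tree t) = if t = RTree.dot then 1 else 0 := by
  refine (MvPolynomial.coeff_X _ _).trans ?_
  simp only [Finsupp.single_left_inj one_ne_zero]

theorem isCharacter_deltaChar : IsCharacter (deltaChar k) := isCharacter_toLinearMap _

theorem isInfChar_deltaDot : IsInfChar (deltaDot k) := by
  intro x y
  classical
  refine (MvPolynomial.coeff_mul x y _).trans ?_
  rw [Finsupp.antidiagonal_single]
  simp [Finset.Nat.antidiagonal_succ, deltaDot, counitCK, add_comm]

theorem IsCharacter.ext_tree {f g : HCK k →ₗ[k] k} (hf : IsCharacter f) (hg : IsCharacter g)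
    (h : ∀ t, f (HCK.tree t) = g (HCK.tree t)) : f = g := by
  obtain ⟨x, rfl⟩ := hf.exists_algHom
  obtain ⟨y, rfl⟩ := hg.exists_algHom
  exact congrArg _ (algHom_ext_tree fun t => h _)

theorem IsInfChar.map_one {f : HCK k →ₗ[k] k} (hf : IsInfChar f) : f 1 = 0 := by
  simpa [isCharacter_counitCK.1] using hf 1 1

theorem IsInfChar.ext_tree {f g : HCK k →ₗ[k] k} (hf : IsInfChar f) (hg : IsInfChar g)
    (h : ∀ t, f (HCK.tree t) = g (HCK.tree t)) : f = g := by
  refine LinearMap.ext fun p => ?_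
  induction p using MvPolynomial.induction_on with
  | C a =>
    rw [← mul_one (MvPolynomial.C a), ← MvPolynomial.smul_eq_C_mul, map_smul, map_smul,
      hf.map_one, hg.map_one]
  | add p q hp hq => rw [map_add, map_add, hp, hq]
  | mul_X p t hp =>
    have tree_eq : f (MvPolynomial.X t) = g (MvPolynomial.X t) := h t
    rw [hf, hg, hp, tree_eq]

open Classical in
theorem map_contractAlgHom_tree_of_ite {f : HCK k →ₗ[k] k}
    (hf : ∀ t, f (HCK.tree t) = if t = RTree.dot then 1 else 0) (w : RTree → k) (t : RTree) :
    f (contractAlgHom w (HCK.tree t)) = w t := by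
  obtain ⟨t, rfl⟩ := RTree.mk_surjective t
  rw [map_contractAlgHom_tree]
  simp only [hf, PTree.mk_eq_dot_iff]
  exact PTree.sumContractions_ite_eq_dot _ t

theorem eq_deltaChar_comp_contractAlgHom_iff {b : HCK k →ₗ[k] k} {w : RTree → k} :
    b = deltaChar k ∘ₗ (contractAlgHom w).toLinearMap ↔
      IsCharacter b ∧ ∀ t, b (HCK.tree t) = w t := by
  have tree_eq := map_contractAlgHom_tree_of_ite (deltaChar_tree (k := k)) w
  have isCharacter_comp := isCharacter_deltaChar.comp_algHom (contractAlgHom w)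
  refine ⟨?_, fun h => h.1.ext_tree isCharacter_comp fun t => (h.2 t).trans (tree_eq t).symm⟩
  rintro rfl
  exact ⟨isCharacter_comp, tree_eq⟩

theorem eq_deltaDot_comp_contractAlgHom_iff {ξ : HCK k →ₗ[k] k} {w : RTree → k} :
    ξ = deltaDot k ∘ₗ (contractAlgHom w).toLinearMap ↔
      IsInfChar ξ ∧ ∀ t, ξ (HCK.tree t) = w t := by
  have tree_eq := map_contractAlgHom_tree_of_ite (deltaDot_tree (k := k)) w
  have isInfChar_comp := isInfChar_deltaDot.comp_contractAlgHom w
  refine ⟨?_, fun h => h.1.ext_tree isInfChar_comp fun t => (h.2 t).trans (tree_eq t).symm⟩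
  rintro rfl
  exact ⟨isInfChar_comp, tree_eq⟩

theorem eq_starH_deltaDot_iff {φ : H k →ₗ[k] k} (hφ : IsCharacter φ) (ξ : HCK k →ₗ[k] k) :
    ξ = starH φ (deltaDot k) ↔ IsInfChar ξ ∧ ∀ t, ξ (HCK.tree t) = φ (H.tree t) := by
  rw [starH_eq hφ, eq_deltaDot_comp_contractAlgHom_iff]

theorem eq_starH_deltaChar_iff {φ : H k →ₗ[k] k} (hφ : IsCharacter φ) (b : HCK k →ₗ[k] k) :
    b = starH φ (deltaChar k) ↔ IsCharacter b ∧ ∀ t, b (HCK.tree t) = φ (H.tree t) := by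
  rw [starH_eq hφ, eq_deltaChar_comp_contractAlgHom_iff]

theorem eq_starHTilde_deltaDot_iff {φ : HTilde k →ₗ[k] k} (hφ : IsCharacter φ)
    (ξ : HCK k →ₗ[k] k) :
    ξ = starHTilde φ (deltaDot k) ↔
      IsInfChar ξ ∧ ∀ t, ξ (HCK.tree t) = φ (HTilde.tree t) := by
  rw [starHTilde_eq hφ, eq_deltaDot_comp_contractAlgHom_iff]

theorem eq_starHTilde_deltaChar_iff {φ : HTilde k →ₗ[k] k} (hφ : IsCharacter φ)
    (b : HCK k →ₗ[k] k) :
    b = starHTilde φ (deltaChar k) ↔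
      IsCharacter b ∧ ∀ t, b (HCK.tree t) = φ (HTilde.tree t) := by
  rw [starHTilde_eq hφ, eq_deltaChar_comp_contractAlgHom_iff]

theorem bijOn_character_HTilde :
    Set.BijOn (fun (φ : HTilde k →ₗ[k] k) t => φ (HTilde.tree t)) {φ | IsCharacter φ} .univ := by
  refine ⟨fun _ _ => trivial, fun φ hφ ψ hψ h => hφ.ext_tree hψ (congrFun h), fun w _ => ?_⟩
  exact ⟨(MvPolynomial.aeval w).toLinearMap, isCharacter_toLinearMap _,
    funext fun t => MvPolynomial.aeval_X w t⟩

theorem H.tree_dot : (H.tree RTree.dot : H k) = 1 := dif_pos rfl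

theorem H.tree_of_ne_dot (t : {t : RTree // t ≠ RTree.dot}) :
    (H.tree t : H k) = MvPolynomial.X t :=
  dif_neg t.2

theorem bijOn_character_H :
    Set.BijOn (fun (φ : H k →ₗ[k] k) t => φ (H.tree t)) {φ | IsCharacter φ}
      {w | w RTree.dot = 1} := by
  refine ⟨fun φ hφ => (congrArg φ H.tree_dot).trans hφ.1, fun φ hφ ψ hψ h => ?_, fun w hw => ?_⟩
  · obtain ⟨x, rfl⟩ := IsCharacter.exists_algHom hφ
    obtain ⟨y, rfl⟩ := IsCharacter.exists_algHom hψ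
    refine congrArg _ (MvPolynomial.algHom_ext fun t => ?_)
    rw [← H.tree_of_ne_dot]
    exact congrFun h t
  · let x : H k →ₐ[k] k := MvPolynomial.aeval fun t => w t
    refine ⟨x.toLinearMap, isCharacter_toLinearMap x, funext fun t => ?_⟩
    obtain rfl | ht := eq_or_ne t RTree.dot
    · exact (congrArg x H.tree_dot).trans ((map_one x).trans hw.symm)
    · exact (congrArg x (H.tree_of_ne_dot ⟨t, ht⟩)).trans (MvPolynomial.aeval_X _ _)

theorem bijOn_of_eq_iff_forall_tree_eq {Φ : Type*} {star : Φ → HCK k →ₗ[k] k} {val : Φ → RTree → k}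
    {X : Set Φ} {W : Set (RTree → k)} {P : (HCK k →ₗ[k] k) → Prop} (hval : Set.BijOn val X W)
    (hstar : ∀ φ ∈ X, ∀ ξ, ξ = star φ ↔ P ξ ∧ ∀ t, ξ (HCK.tree t) = val φ t) :
    Set.BijOn star X {ξ | P ξ ∧ (fun t => ξ (HCK.tree t)) ∈ W} := by
  have star_tree {φ} (hφ : φ ∈ X) : (fun t => star φ (HCK.tree t)) = val φ :=
    funext ((hstar φ hφ _).1 rfl).2
  refine ⟨fun φ hφ => ⟨((hstar φ hφ _).1 rfl).1, ?_⟩, fun φ hφ ψ hψ h => ?_, fun ξ hξ => ?_⟩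
  · rw [star_tree hφ]
    exact hval.mapsTo hφ
  · refine hval.injOn hφ hψ ?_
    rw [← star_tree hφ, h, star_tree hψ]
  · obtain ⟨φ, hφ, val_eq⟩ := hval.surjOn hξ.2
    exact ⟨φ, hφ, ((hstar φ hφ ξ).2 ⟨hξ.1, fun t => (congrFun val_eq t).symm⟩).symm⟩

theorem bijOn_starH_deltaDot :
    Set.BijOn (fun φ : H k →ₗ[k] k => starH φ (deltaDot k)) {φ | IsCharacter φ}
      {ξ | IsInfChar ξ ∧ ξ (HCK.tree RTree.dot) = 1} :=
  bijOn_of_eq_iff_forall_tree_eq bijOn_character_H fun _ => eq_starH_deltaDot_iff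

theorem bijOn_starH_deltaChar :
    Set.BijOn (fun φ : H k →ₗ[k] k => starH φ (deltaChar k)) {φ | IsCharacter φ}
      {b | IsCharacter b ∧ b (HCK.tree RTree.dot) = 1} :=
  bijOn_of_eq_iff_forall_tree_eq bijOn_character_H fun _ => eq_starH_deltaChar_iff

theorem bijOn_starHTilde_deltaDot :
    Set.BijOn (fun φ : HTilde k →ₗ[k] k => starHTilde φ (deltaDot k)) {φ | IsCharacter φ}
      {ξ | IsInfChar ξ} := by
  simpa only [Set.mem_univ, and_true] using
    bijOn_of_eq_iff_forall_tree_eq bijOn_character_HTilde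
      fun _ => eq_starHTilde_deltaDot_iff (k := k)

theorem bijOn_starHTilde_deltaChar :
    Set.BijOn (fun φ : HTilde k →ₗ[k] k => starHTilde φ (deltaChar k)) {φ | IsCharacter φ}
      {b | IsCharacter b} := by
  simpa only [Set.mem_univ, and_true] using
    bijOn_of_eq_iff_forall_tree_eq bijOn_character_HTilde
      fun _ => eq_starHTilde_deltaChar_iff (k := k)

/-- The character `t ↦ (-1) ^ |t|` of the Connes-Kreimer algebra, which is the convolution inverse
of `deltaChar`. -/
def signAlgHom : HCK k →ₐ[k] k := MvPolynomial.aeval fun t => (-1) ^ t.numVertices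

theorem signAlgHom_tree (t : PTree) :
    signAlgHom (HCK.tree (RTree.mk t) : HCK k) = (-1) ^ t.numVertices :=
  MvPolynomial.aeval_X _ _

open Classical in
theorem isConvInv_deltaChar_signAlgHom :
    IsConvInv (deltaChar k) (signAlgHom (k := k)).toLinearMap := by
  let δ : HCK k →ₐ[k] k := MvPolynomial.aeval fun t => if t = RTree.dot then 1 else 0
  have delta_tree (t : PTree) : δ (HCK.tree (RTree.mk t)) = if t = PTree.dot then 1 else 0 := by
    simp only [← PTree.mk_eq_dot_iff]
    exact deltaChar_tree _
  have isCharacter_sign := isCharacter_toLinearMap (signAlgHom (k := k))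
  constructor
  · refine (isCharacter_convCK isCharacter_deltaChar isCharacter_sign).ext_tree
      isCharacter_counitCK (RTree.mk_surjective.forall.2 fun t => ?_)
    refine (convCK_toLinearMap_tree δ signAlgHom t).trans ?_
    simp only [delta_tree, signAlgHom_tree, PTree.sumCuts_dot_sign, counitCK_tree]
    split_ifs <;> simp
  · refine (isCharacter_convCK isCharacter_sign isCharacter_deltaChar).ext_tree
      isCharacter_counitCK (RTree.mk_surjective.forall.2 fun t => ?_)
    refine (convCK_toLinearMap_tree signAlgHom δ t).trans ?_
    simp only [delta_tree, signAlgHom_tree, PTree.sumCuts_sign_dot, counitCK_tree, add_neg_cancel]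

theorem IsCharacter.existsUnique_isConvInv {b : HCK k →ₗ[k] k} (hb : IsCharacter b) :
    ∃! c, IsConvInv b c := by
  have b_eq := eq_deltaChar_comp_contractAlgHom_iff.2 ⟨hb, fun _ => rfl⟩
  have inv := isConvInv_deltaChar_signAlgHom.comp_contractAlgHom fun t => b (HCK.tree t)
  rw [← b_eq] at inv
  exact ⟨_, inv, fun _ h => h.unique inv⟩

theorem IsConvInv.starH {f g : HCK k →ₗ[k] k} (h : IsConvInv f g) {φ : H k →ₗ[k] k}
    (hφ : IsCharacter φ) : IsConvInv (starH φ f) (starH φ g) := by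
  rw [starH_eq hφ, starH_eq hφ]
  exact h.comp_contractAlgHom _

theorem IsConvInv.starHTilde {f g : HCK k →ₗ[k] k} (h : IsConvInv f g) {φ : HTilde k →ₗ[k] k}
    (hφ : IsCharacter φ) : IsConvInv (starHTilde φ f) (starHTilde φ g) := by
  rw [starHTilde_eq hφ, starHTilde_eq hφ]
  exact h.comp_contractAlgHom _

end

end TreeHopf

open TreeHopf in
theorem mainTheorem4_general (k : Type*) [Field k] :
    ((∀ φ : H k →ₗ[k] k, IsCharacter φ → ∀ ξ : HCK k →ₗ[k] k,
        ξ = starH φ (deltaDot k) ↔ IsInfChar ξ ∧ ∀ t, ξ (HCK.tree t) = φ (H.tree t)) ∧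
      Set.BijOn (fun φ : H k →ₗ[k] k => starH φ (deltaDot k)) {φ | IsCharacter φ}
        {ξ | IsInfChar ξ ∧ ξ (HCK.tree RTree.dot) = 1}) ∧
    ((∀ φ : H k →ₗ[k] k, IsCharacter φ → ∀ b : HCK k →ₗ[k] k,
        b = starH φ (deltaChar k) ↔ IsCharacter b ∧ ∀ t, b (HCK.tree t) = φ (H.tree t)) ∧
      Set.BijOn (fun φ : H k →ₗ[k] k => starH φ (deltaChar k)) {φ | IsCharacter φ}
        {b | IsCharacter b ∧ b (HCK.tree RTree.dot) = 1}) ∧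
    ((∀ φ : HTilde k →ₗ[k] k, IsCharacter φ → ∀ ξ : HCK k →ₗ[k] k,
        ξ = starHTilde φ (deltaDot k) ↔
          IsInfChar ξ ∧ ∀ t, ξ (HCK.tree t) = φ (HTilde.tree t)) ∧
      Set.BijOn (fun φ : HTilde k →ₗ[k] k => starHTilde φ (deltaDot k)) {φ | IsCharacter φ}
        {ξ | IsInfChar ξ}) ∧
    ((∀ φ : HTilde k →ₗ[k] k, IsCharacter φ → ∀ b : HCK k →ₗ[k] k,
        b = starHTilde φ (deltaChar k) ↔
          IsCharacter b ∧ ∀ t, b (HCK.tree t) = φ (HTilde.tree t)) ∧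
      Set.BijOn (fun φ : HTilde k →ₗ[k] k => starHTilde φ (deltaChar k)) {φ | IsCharacter φ}
        {b | IsCharacter b}) ∧
    IsCharacter (deltaChar k) ∧
    (∀ b : HCK k →ₗ[k] k, IsCharacter b → ∃! c, IsConvInv b c) ∧
    (∀ b' : H k →ₗ[k] k, IsCharacter b' → ∀ bInv deltaInv : HCK k →ₗ[k] k,
      IsConvInv (starH b' (deltaChar k)) bInv → IsConvInv (deltaChar k) deltaInv →
        bInv = starH b' deltaInv) ∧
    (∀ b' : HTilde k →ₗ[k] k, IsCharacter b' → ∀ bInv deltaInv : HCK k →ₗ[k] k,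
      IsConvInv (starHTilde b' (deltaChar k)) bInv → IsConvInv (deltaChar k) deltaInv →
        bInv = starHTilde b' deltaInv) :=
  ⟨⟨fun _ => eq_starH_deltaDot_iff, bijOn_starH_deltaDot⟩,
    ⟨fun _ => eq_starH_deltaChar_iff, bijOn_starH_deltaChar⟩,
    ⟨fun _ => eq_starHTilde_deltaDot_iff, bijOn_starHTilde_deltaDot⟩,
    ⟨fun _ => eq_starHTilde_deltaChar_iff, bijOn_starHTilde_deltaChar⟩,
    isCharacter_deltaChar,
    fun _ => IsCharacter.existsUnique_isConvInv,
    fun _ hφ _ _ hb hδ => hb.unique (hδ.starH hφ),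
    fun _ hφ _ _ hb hδ => hb.unique (hδ.starHTilde hφ)⟩

theorem mainTheorem4 (k : Type*) [Field k] [CharZero k] :
    -- characters of the Hopf algebra `H`, infinitesimal characters of `H_CK`
    ((∀ φ : TreeHopf.H k →ₗ[k] k, TreeHopf.IsCharacter φ →
        ∀ ξ : TreeHopf.HCK k →ₗ[k] k, ξ = TreeHopf.starH φ (TreeHopf.deltaDot k) ↔
          TreeHopf.IsInfChar ξ ∧
            ∀ t : TreeHopf.RTree, ξ (TreeHopf.HCK.tree t) = φ (TreeHopf.H.tree t)) ∧
      Set.BijOn (fun φ : TreeHopf.H k →ₗ[k] k => TreeHopf.starH φ (TreeHopf.deltaDot k))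
        {φ | TreeHopf.IsCharacter φ}
        {ξ | TreeHopf.IsInfChar ξ ∧ ξ (TreeHopf.HCK.tree TreeHopf.RTree.dot) = 1}) ∧
    -- characters of the Hopf algebra `H`, characters of `H_CK`
    ((∀ φ : TreeHopf.H k →ₗ[k] k, TreeHopf.IsCharacter φ →
        ∀ b : TreeHopf.HCK k →ₗ[k] k, b = TreeHopf.starH φ (TreeHopf.deltaChar k) ↔
          TreeHopf.IsCharacter b ∧
            ∀ t : TreeHopf.RTree, b (TreeHopf.HCK.tree t) = φ (TreeHopf.H.tree t)) ∧
      Set.BijOn (fun φ : TreeHopf.H k →ₗ[k] k => TreeHopf.starH φ (TreeHopf.deltaChar k))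
        {φ | TreeHopf.IsCharacter φ}
        {b | TreeHopf.IsCharacter b ∧ b (TreeHopf.HCK.tree TreeHopf.RTree.dot) = 1}) ∧
    -- characters of the bialgebra `H̃`, infinitesimal characters of `H_CK`
    ((∀ φ : TreeHopf.HTilde k →ₗ[k] k, TreeHopf.IsCharacter φ →
        ∀ ξ : TreeHopf.HCK k →ₗ[k] k, ξ = TreeHopf.starHTilde φ (TreeHopf.deltaDot k) ↔
          TreeHopf.IsInfChar ξ ∧
            ∀ t : TreeHopf.RTree, ξ (TreeHopf.HCK.tree t) = φ (TreeHopf.HTilde.tree t)) ∧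
      Set.BijOn (fun φ : TreeHopf.HTilde k →ₗ[k] k => TreeHopf.starHTilde φ (TreeHopf.deltaDot k))
        {φ | TreeHopf.IsCharacter φ} {ξ | TreeHopf.IsInfChar ξ}) ∧
    -- characters of the bialgebra `H̃`, characters of `H_CK`
    ((∀ φ : TreeHopf.HTilde k →ₗ[k] k, TreeHopf.IsCharacter φ →
        ∀ b : TreeHopf.HCK k →ₗ[k] k, b = TreeHopf.starHTilde φ (TreeHopf.deltaChar k) ↔
          TreeHopf.IsCharacter b ∧
            ∀ t : TreeHopf.RTree, b (TreeHopf.HCK.tree t) = φ (TreeHopf.HTilde.tree t)) ∧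
      Set.BijOn (fun φ : TreeHopf.HTilde k →ₗ[k] k => TreeHopf.starHTilde φ (TreeHopf.deltaChar k))
        {φ | TreeHopf.IsCharacter φ} {b | TreeHopf.IsCharacter b}) ∧
    -- characters of `H_CK`, in particular `δ`, have a unique convolution inverse
    TreeHopf.IsCharacter (TreeHopf.deltaChar k) ∧
    (∀ b : TreeHopf.HCK k →ₗ[k] k, TreeHopf.IsCharacter b →
      ∃! c : TreeHopf.HCK k →ₗ[k] k, TreeHopf.IsConvInv b c) ∧
    -- the inverse of `b = b̃ ⋆ δ`, for the Hopf algebra `H`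
    (∀ b : TreeHopf.HCK k →ₗ[k] k, TreeHopf.IsCharacter b →
      b (TreeHopf.HCK.tree TreeHopf.RTree.dot) = 1 →
      ∀ b' : TreeHopf.H k →ₗ[k] k, TreeHopf.IsCharacter b' →
        b = TreeHopf.starH b' (TreeHopf.deltaChar k) →
        ∀ bInv deltaInv : TreeHopf.HCK k →ₗ[k] k,
          TreeHopf.IsConvInv b bInv → TreeHopf.IsConvInv (TreeHopf.deltaChar k) deltaInv →
          bInv = TreeHopf.starH b' deltaInv) ∧
    -- the inverse of `b = b̃ ⋆ δ`, for the bialgebra `H̃`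
    (∀ b : TreeHopf.HCK k →ₗ[k] k, TreeHopf.IsCharacter b →
      ∀ b' : TreeHopf.HTilde k →ₗ[k] k, TreeHopf.IsCharacter b' →
        b = TreeHopf.starHTilde b' (TreeHopf.deltaChar k) →
        ∀ bInv deltaInv : TreeHopf.HCK k →ₗ[k] k,
          TreeHopf.IsConvInv b bInv → TreeHopf.IsConvInv (TreeHopf.deltaChar k) deltaInv →
          bInv = TreeHopf.starHTilde b' deltaInv) :=
  have ⟨infH, charH, infTilde, charTilde, delta, inv, invH, invTilde⟩ := mainTheorem4_general k
  ⟨infH, charH, infTilde, charTilde, delta, inv,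
    fun _ _ _ φ hφ h => h ▸ invH φ hφ, fun _ _ φ hφ h => h ▸ invTilde φ hφ⟩
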